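/- Let $n$ be a natural number and let $A_0,\dots,A_{n-1}$ be subspaces of $\omega_1$, where $\omega_1$ carries the order topology. Then the product space $\prod_{i<n}A_i$ is semi-proximal if and only if it is normal. Here, for a space $X$ and a uniformity $\mathfrak U$ on $X$ compatible with its topology, the proximal game on $(X,\mathfrak U)$ is played as follows. In inning $0$, Player I chooses $U_0\in\mathfrak U$ and Player II chooses $x_0\in X$; in inning $k+1$, Player I chooses $U_{k+1}\in\mathfrak U$ with $U_{k+1}\subseteq U_k$, and Player II chooses $x_{k+1}\in U_k[x_k]=\{y\in X:\langle x_k,y\rangle\in U_k\}$. Player I wins if $\bigcap_{k<\omega}U_k[x_k]=\emptyset$ or the sequence $(x_k)_{k<\omega}$ converges in $X$; otherwise Player II wins. The space $X$ is semi-proximal if there is a compatible uniformity $\mathfrak U$ on $X$ such that Player II has no winning strategy in the proximal game on $(X,\mathfrak U)$. -/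

import Mathlib

open scoped Ordinal Uniformity

/-- Legal runs of Player I in the proximal game: a decreasing sequence of entourages. -/
def IsProximalRunI {X : Type*} [UniformSpace X] (U : ℕ → Set (X × X)) : Prop :=
  (∀ n, U n ∈ 𝓤 X) ∧ ∀ n, U (n + 1) ⊆ U n

/-- Player II's moves `x` obey the rules against `U`: for every `n`, the point `x (n + 1)` lies in
`U n [x n] = {y | (x n, y) ∈ U n}`. -/
def IsProximalRunII {X : Type*} (U : ℕ → Set (X × X)) (x : ℕ → X) : Prop :=
  ∀ n, (x n, x (n + 1)) ∈ U n

/-- Player I wins a run of the proximal game iff `⋂ n, U n [x n]` is empty or the sequence `x`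
converges. -/
def ProximalWinI {X : Type*} [TopologicalSpace X] (U : ℕ → Set (X × X)) (x : ℕ → X) : Prop :=
  (⋂ n, {y : X | (x n, y) ∈ U n}) = ∅ ∨ ∃ a : X, Filter.Tendsto x Filter.atTop (nhds a)

/-- A strategy for Player II: a choice of a point in every inning `n`, depending on the moves
`U 0, …, U n` that Player I has made so far (the earlier points chosen by Player II are determined
by these moves and the strategy). -/
abbrev ProximalStrategyII (X : Type*) : Type _ :=
  (n : ℕ) → (Fin (n + 1) → Set (X × X)) → X

/-- The points that Player II chooses when following `σ` against `U`. -/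
def ProximalStrategyII.play {X : Type*} (σ : ProximalStrategyII X) (U : ℕ → Set (X × X)) :
    ℕ → X :=
  fun n => σ n fun i => U i

/-- `σ` is a winning strategy for Player II: against every legal run of Player I it plays by the
rules, and Player I does not win. -/
def ProximalStrategyII.IsWinning {X : Type*} [UniformSpace X] (σ : ProximalStrategyII X) : Prop :=
  ∀ U : ℕ → Set (X × X), IsProximalRunI U →
    IsProximalRunII U (σ.play U) ∧ ¬ ProximalWinI U (σ.play U)

/-- A topological space is semi-proximal if it has a compatible uniformity for which Player II has
no winning strategy in the proximal game. -/
def IsSemiProximal (X : Type*) [t : TopologicalSpace X] : Prop :=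
  ∃ u : UniformSpace X, u.toTopologicalSpace = t ∧
    ¬ ∃ σ : ProximalStrategyII X, @ProximalStrategyII.IsWinning X u σ

/-- The space `ω₁` of countable ordinals. Its topology, as a subspace of the ordinals, is the order
topology. -/
abbrev OmegaOne : Type 1 := Set.Iio (ω₁ : Ordinal.{0})

theorem omegaOne_orderTopology : OrderTopology OmegaOne := inferInstance

open Set Filter Topology

/-! ### Countable ordinals, stationary sets and clubs -/

namespace OmegaOne

/-! For a nonempty product, both properties are equivalent to stationarity of `stationaryCore A`,
the intersection of the stationary factors. An empty product has both properties trivially.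

Let the core be stationary. Closing off under countably many choices gives `δ` in the core such that
every choice made from finitely many ordinals below `δ` stays below `δ`. Cutting along an
enumeration of `Iio δ` then forces convergence to a point whose coordinates are at most `δ`. Player
I beats a given strategy this way (`isSemiProximal_of_stationary`). The same argument shows that
disjoint closed sets cannot both meet every tail box (`exists_disjoint_box`), and an induction on
the set of unbounded coordinates turns this into normality. Nonstationary factors are cut into
bounded pieces by clubs that miss them.

If the core is not stationary and the product is nonempty, the product contains a closed copy of `B
× C` with `B`, `C` disjoint and stationary (`exists_isClosedEmbedding`). Pressing down shows that `B
× C` is not normal. It also shows that continuous maps from `B × C` to a uniform space are Cauchy at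
infinity, so Player II can move along points of the tails whose coordinates interlace. A limit in `B
× C` would have equal coordinates, which disjointness forbids. -/

theorem countable_Iio (x : OmegaOne) : (Iio x).Countable := by
  have h : (Iio (x : Ordinal.{0})).Countable := by
    rw [← Cardinal.le_aleph0_iff_set_countable, Cardinal.mk_Iio_ordinal,
      ← Cardinal.lift_aleph0.{1, 0}, Cardinal.lift_le]
    have hx : (x : Ordinal.{0}) < (Cardinal.aleph 1).ord := by
      rw [Cardinal.ord_aleph]
      exact x.2
    rw [← Order.lt_succ_iff, Cardinal.succ_aleph0]
    exact Cardinal.lt_ord.1 hx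
  exact (h.preimage (f := ((↑) : OmegaOne → Ordinal.{0})) Subtype.val_injective).mono
    fun y hy => hy

theorem exists_forall_lt {ι : Type*} [Countable ι] (f : ι → OmegaOne) : ∃ y, ∀ i, f i < y := by
  have h1 : ⨆ i, Order.succ (f i : Ordinal.{0}) < ω₁ :=
    Ordinal.iSup_lt_omega_one fun i =>
      (Cardinal.isSuccLimit_omega 1).succ_lt (f i).2
  refine ⟨⟨_, h1⟩, fun i => ?_⟩
  have : BddAbove (range fun i => Order.succ (f i : Ordinal.{0})) :=
    ⟨ω₁, by rintro _ ⟨i, rfl⟩; exact ((Cardinal.isSuccLimit_omega 1).succ_lt (f i).2).le⟩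
  exact (Order.lt_succ (f i : Ordinal.{0})).trans_le (le_ciSup this i)

theorem exists_forall_lt_of_countable {s : Set OmegaOne} (hs : s.Countable) :
    ∃ y, ∀ x ∈ s, x < y := by
  have := hs.to_subtype
  obtain ⟨y, hy⟩ := exists_forall_lt (fun x : s => (x : OmegaOne))
  exact ⟨y, fun x hx => hy ⟨x, hx⟩⟩

instance : Nonempty OmegaOne :=
  (exists_forall_lt Empty.elim).nonempty

instance : NoMaxOrder OmegaOne :=
  ⟨fun x => (exists_forall_lt fun _ : Unit => x).imp fun _ h => h ()⟩

theorem countable_Iic (x : OmegaOne) : (Iic x).Countable := by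
  obtain ⟨y, hy⟩ := exists_gt x
  exact (countable_Iio y).mono fun z hz => mem_Iio.2 ((mem_Iic.1 hz).trans_lt hy)

theorem isClopen_Iic (x : OmegaOne) : IsClopen (Iic x) := by
  refine ⟨isClosed_Iic, ?_⟩
  have hne : (Ioi x).Nonempty := exists_gt x
  have : Iic x = Iio (wellFounded_lt.min (Ioi x) hne) := by
    ext z
    refine ⟨fun hz => mem_Iio.2 ((mem_Iic.1 hz).trans_lt
      (mem_Ioi.1 (wellFounded_lt.min_mem (Ioi x) hne))), fun hz => ?_⟩
    by_contra h
    exact wellFounded_lt.not_lt_min (Ioi x) (mem_Ioi.2 (not_le.1 fun hle => h (mem_Iic.2 hle))) hz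
  rw [this]
  exact isOpen_Iio

theorem isClopen_Ioi (x : OmegaOne) : IsClopen (Ioi x) := by
  rw [← compl_Iic]
  exact (isClopen_Iic x).compl

/-- Neighbourhoods of a point that is not the least one. -/
theorem exists_Ioc_subset {x y : OmegaOne} (hy : y < x) {s : Set OmegaOne} (hs : s ∈ 𝓝 x) :
    ∃ z < x, Ioc z x ⊆ s :=
  exists_Ioc_subset_of_mem_nhds hs ⟨y, hy⟩

theorem exists_isClopen_subset {x : OmegaOne} {s : Set OmegaOne} (hs : s ∈ 𝓝 x) :
    ∃ V, IsClopen V ∧ x ∈ V ∧ V ⊆ s := by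
  by_cases h : ∃ y, y < x
  · obtain ⟨y, hy⟩ := h
    obtain ⟨z, hz, hzs⟩ := exists_Ioc_subset hy hs
    exact ⟨Ioi z ∩ Iic x, (isClopen_Ioi z).inter (isClopen_Iic x), ⟨hz, self_mem_Iic⟩, hzs⟩
  · refine ⟨Iic x, isClopen_Iic x, self_mem_Iic, fun z hz => ?_⟩
    have : z = x := le_antisymm hz (not_lt.1 fun hzx => h ⟨z, hzx⟩)
    exact this ▸ mem_of_mem_nhds hs

/-- A sequence below `δ` that, for each `z < δ`, is eventually on the same side of `z` as `y`
converges to `min y δ`. -/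
theorem tendsto_min {δ y : OmegaOne} {x : ℕ → OmegaOne} (hx : ∀ k, x k < δ)
    (hz : ∀ z < δ, ∀ᶠ k in atTop, (x k ≤ z ↔ y ≤ z)) : Tendsto x atTop (𝓝 (min y δ)) := by
  rw [tendsto_order]
  refine ⟨fun a ha => ?_, fun a ha => ?_⟩
  · filter_upwards [hz a (ha.trans_le (min_le_right _ _))] with k hk
    rw [← not_le, hk, not_le]
    exact ha.trans_le (min_le_left _ _)
  · rcases lt_or_ge y δ with h | h
    · rw [min_eq_left h.le] at ha
      filter_upwards [hz y h] with k hk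
      exact (hk.2 le_rfl).trans_lt ha
    · rw [min_eq_right h] at ha
      exact Eventually.of_forall fun k => (hx k).trans ha

/-- A set of countable ordinals is stationary if it contains, for every function on `ω₁`, a nonzero
ordinal that is closed under this function. -/
def Stationary (S : Set OmegaOne) : Prop :=
  ∀ f : OmegaOne → OmegaOne, ∃ δ ∈ S, (∃ x, x < δ) ∧ ∀ x < δ, f x < δ

theorem Stationary.mono {S T : Set OmegaOne} (h : Stationary S) (hST : S ⊆ T) : Stationary T :=
  fun f => (h f).imp fun _ hδ => ⟨hST hδ.1, hδ.2⟩

/-- A stationary set meets the club of the ordinals closed under a function of lists. -/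
theorem Stationary.exists_closed_list {S : Set OmegaOne} (hS : Stationary S)
    (g : List OmegaOne → OmegaOne) (f : OmegaOne → OmegaOne) (α : OmegaOne) :
    ∃ δ ∈ S, α < δ ∧ (∀ x < δ, f x < δ) ∧ ∀ l : List OmegaOne, (∀ z ∈ l, z < δ) → g l < δ := by
  have hex : ∀ x : OmegaOne, ∃ y, (∀ l : List OmegaOne, (∀ z ∈ l, z ≤ x) → g l < y) ∧
      α < y ∧ f x < y := by
    intro x
    -- Only countably many finite lists lie below `x`, so one ordinal bounds `g` on all of them.
    have hc : {l : List OmegaOne | ∀ z ∈ l, z ∈ Iic x}.Countable := by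
        have := (countable_Iic x).to_subtype
        rw [← range_list_map_coe]
        exact countable_range _
    obtain ⟨y, hy⟩ := exists_forall_lt_of_countable
      ((hc.image g).union ((countable_singleton α).union (countable_singleton (f x))))
    exact ⟨y, fun l hl => hy _ (Or.inl ⟨l, hl, rfl⟩), hy _ (by simp), hy _ (by simp)⟩
  choose F hF using hex
  obtain ⟨δ, hδS, ⟨x₀, hx₀⟩, hδ⟩ := hS F
  refine ⟨δ, hδS, (hF x₀).2.1.trans (hδ _ hx₀), fun x hx => (hF x).2.2.trans (hδ _ hx), ?_⟩
  intro l hl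
  have : ∃ x < δ, ∀ z ∈ l, z ≤ x := by
    induction l with
    | nil => exact ⟨x₀, hx₀, by simp⟩
    | cons a l ih =>
      obtain ⟨x, hx, hxl⟩ := ih fun z hz => hl z (List.mem_cons_of_mem _ hz)
      refine ⟨max a x, max_lt (hl a List.mem_cons_self) hx, ?_⟩
      intro z hz
      rcases List.mem_cons.1 hz with rfl | hz
      · exact le_max_left _ _
      · exact (hxl z hz).trans (le_max_right _ _)
  obtain ⟨x, hx, hxl⟩ := this
  exact ((hF x).1 l hxl).trans (hδ x hx)

theorem Stationary.exists_closed {S : Set OmegaOne} (hS : Stationary S)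
    (f : OmegaOne → OmegaOne) (α : OmegaOne) : ∃ δ ∈ S, α < δ ∧ ∀ x < δ, f x < δ := by
  obtain ⟨δ, h, h1, h2, -⟩ := hS.exists_closed_list (fun _ => α) f α
  exact ⟨δ, h, h1, h2⟩

theorem Stationary.exists_gt {S : Set OmegaOne} (hS : Stationary S) (α : OmegaOne) :
    ∃ δ ∈ S, α < δ := by
  obtain ⟨δ, h, h1, -⟩ := hS.exists_closed id α
  exact ⟨δ, h, h1⟩

/-- The pressing down lemma. -/
theorem Stationary.press_down {S : Set OmegaOne} (hS : Stationary S) {r : OmegaOne → OmegaOne}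
    (hr : ∀ x ∈ S, (∃ y, y < x) → r x < x) : ∃ γ, ∀ β, ∃ x ∈ S, β < x ∧ r x ≤ γ := by
  by_contra! h
  -- Here `b γ` bounds the points of `S` that `r` sends to at most `γ`. A `δ ∈ S` closed under `b`
  -- contradicts this for `γ = r δ`.
  choose b hb using h
  obtain ⟨δ, hδ, hδ0, hδb⟩ := hS b
  have h1 := hr δ hδ hδ0
  exact (hb (r δ) δ hδ (hδb _ h1)).false

/-- Ordinals closed under a function are unbounded. -/
theorem exists_closed_gt (f : OmegaOne → OmegaOne) (α : OmegaOne) :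
    ∃ δ, α < δ ∧ ∀ x < δ, f x < δ := by
  have hex : ∀ x : OmegaOne, ∃ y, x < y ∧ ∀ z ≤ x, f z < y := by
    intro x
    obtain ⟨y, hy⟩ := exists_forall_lt_of_countable
      (((countable_Iic x).image f).union (countable_singleton x))
    exact ⟨y, hy _ (by simp), fun z hz => hy _ (Or.inl ⟨z, hz, rfl⟩)⟩
  choose F hF using hex
  let a : ℕ → OmegaOne := fun n => F^[n] α
  have ha : ∀ n, a (n + 1) = F (a n) := fun n => Function.iterate_succ_apply' F n α
  have hne : {y | ∀ n, a n < y}.Nonempty := exists_forall_lt a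
  -- The witness is the supremum of the iterates of `F`.
  refine ⟨wellFounded_lt.min _ hne, wellFounded_lt.min_mem _ hne 0, fun x hx => ?_⟩
  have : ∃ n, x ≤ a n := by
    by_contra! h
    exact wellFounded_lt.not_lt_min {y | ∀ n, a n < y} h hx
  obtain ⟨n, hn⟩ := this
  have := (hF (a n)).2 x hn
  rw [← ha] at this
  exact this.trans (wellFounded_lt.min_mem _ hne (n + 1))

theorem isClosed_setOf_closed (f : OmegaOne → OmegaOne) :
    IsClosed {δ : OmegaOne | ∀ x < δ, f x < δ} := by
  have : {δ : OmegaOne | ∀ x < δ, f x < δ} = ⋂ x, (Iic x ∪ Ioi (f x)) := by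
    ext δ
    simp only [mem_ofPred_eq, mem_iInter, mem_union, mem_Iic, mem_Ioi]
    exact forall_congr' fun x => by rw [← not_lt, imp_iff_not_or]
  rw [this]
  exact isClosed_iInter fun x => isClosed_Iic.union (isClopen_Ioi _).1

/-- The nonzero ordinals closed under a function witnessing nonstationarity form the club. The
function is returned too, so that a point can be put into `D` by closing it under `f`. -/
theorem exists_club_of_not_stationary {S : Set OmegaOne} (hS : ¬ Stationary S) :
    ∃ (D : Set OmegaOne) (f : OmegaOne → OmegaOne), IsClosed D ∧ (∀ α, ∃ δ ∈ D, α < δ) ∧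
      Disjoint S D ∧ ∀ α δ, α < δ → (∀ x < δ, f x < δ) → δ ∈ D := by
  simp only [Stationary, not_forall] at hS
  obtain ⟨f, hf⟩ := hS
  obtain ⟨b, hb⟩ : ∃ b : OmegaOne, ∀ x, b ≤ x :=
    ⟨wellFounded_lt.min univ univ_nonempty,
      fun x => not_lt.1 (wellFounded_lt.not_lt_min univ (mem_univ x))⟩
  have hD : ∀ α δ, α < δ → (∀ x < δ, f x < δ) → δ ∈ {δ : OmegaOne | ∀ x < δ, f x < δ} ∩ Ioi b :=
    fun α δ h1 h2 => ⟨h2, (hb α).trans_lt h1⟩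
  -- The least ordinal `b` is vacuously closed under `f` and must be removed.
  refine ⟨{δ : OmegaOne | ∀ x < δ, f x < δ} ∩ Ioi b, f,
    (isClosed_setOf_closed f).inter (isClopen_Ioi b).1, fun α => ?_, ?_, hD⟩
  · obtain ⟨δ, h1, h2⟩ := exists_closed_gt f α
    exact ⟨δ, hD α δ h1 h2, h1⟩
  · rw [disjoint_left]
    exact fun δ h1 h2 => hf ⟨δ, h1, ⟨b, h2.2⟩, h2.1⟩

theorem stationary_univ : Stationary univ := fun f => by
  obtain ⟨x⟩ := (inferInstance : Nonempty OmegaOne)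
  obtain ⟨δ, h1, h2⟩ := exists_closed_gt f x
  exact ⟨δ, mem_univ δ, ⟨x, h1⟩, h2⟩

theorem exists_seq_range_eq_Iio {α δ : OmegaOne} (h : α < δ) :
    ∃ z : ℕ → OmegaOne, range z = Iio δ := by
  obtain ⟨z, hz⟩ := (countable_Iio δ).exists_eq_range ⟨α, h⟩
  exact ⟨z, hz.symm⟩

end OmegaOne

/-! ### Partition uniformities and semi-proximality -/

/-- A zero-dimensional space has a compatible uniformity in which every partition into open sets is
an entourage. -/
theorem exists_uniformSpace_of_clopen_nhds {X : Type*} [t : TopologicalSpace X]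
    (hb : ∀ x : X, ∀ s ∈ 𝓝 x, ∃ V, IsClopen V ∧ x ∈ V ∧ V ⊆ s) :
    ∃ u : UniformSpace X, u.toTopologicalSpace = t ∧
      ∀ r : Setoid X, (∀ x, IsOpen {y | r x y}) → {p : X × X | r p.1 p.2} ∈ 𝓤[u] := by
  let u : UniformSpace X := ⨅ r : {r : Setoid X // ∀ x, IsOpen {y | r x y}},
    UniformSpace.comap (Quotient.mk r.1) ⊥
  have hu : ∀ r : Setoid X, (∀ x, IsOpen {y | r x y}) → {p : X × X | r p.1 p.2} ∈ 𝓤[u] := by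
    intro r hr
    have h1 : u ≤ UniformSpace.comap (Quotient.mk r) ⊥ :=
      iInf_le (fun r : {r : Setoid X // ∀ x, IsOpen {y | r x y}} =>
        UniformSpace.comap (Quotient.mk r.1) ⊥) ⟨r, hr⟩
    refine h1 ?_
    refine mem_comap.2 ⟨SetRel.id, mem_principal_self _, fun p hp => ?_⟩
    exact Quotient.exact hp
  refine ⟨u, le_antisymm ?_ ?_, hu⟩
  · rw [← continuous_id_iff_le]
    refine (@continuous_iff_continuousAt X X u.toTopologicalSpace t id).2 fun x s hs => ?_
    obtain ⟨V, hV, hxV, hVs⟩ := hb x s hs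
    have h1 : {p : X × X | p.1 ∈ V ↔ p.2 ∈ V} ∈ 𝓤[u] := by
      refine hu ⟨fun x y => x ∈ V ↔ y ∈ V, fun x => Iff.rfl, fun h => h.symm,
        fun h h' => h.trans h'⟩ fun x => ?_
      by_cases hx : x ∈ V
      · convert hV.2 using 1
        ext y
        exact ⟨fun h => h.1 hx, fun h => iff_of_true hx h⟩
      · convert hV.compl.2 using 1
        ext y
        exact ⟨fun h hy => hx (h.2 hy), fun h => iff_of_false hx h⟩
    have h2 := @UniformSpace.ball_mem_nhds X u x _ h1
    refine mem_map.2 (Filter.mem_of_superset h2 fun y hy => hVs ?_)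
    exact (show x ∈ V ↔ y ∈ V from hy).1 hxV
  · rw [UniformSpace.toTopologicalSpace_iInf]
    refine le_iInf fun r => ?_
    rw [UniformSpace.toTopologicalSpace_comap]
    rw [← continuous_iff_le_induced]
    refine continuous_def.2 fun s _ => ?_
    refine isOpen_iff_mem_nhds.2 fun x hx => ?_
    refine Filter.mem_of_superset ((r.2 x).mem_nhds (r.1.refl x)) fun y hy => ?_
    have : Quotient.mk r.1 x = Quotient.mk r.1 y := Quotient.sound hy
    rw [mem_preimage, ← this]
    exact hx

namespace OmegaOne

variable {n : ℕ} {A : Fin n → Set OmegaOne}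

theorem exists_isClopen_subset_pi (x : (i : Fin n) → A i) {s : Set ((i : Fin n) → A i)}
    (hs : s ∈ 𝓝 x) : ∃ V, IsClopen V ∧ x ∈ V ∧ V ⊆ s := by
  rw [nhds_pi, Filter.mem_pi] at hs
  obtain ⟨I, -, t, ht, hts⟩ := hs
  have : ∀ i, ∃ V : Set OmegaOne, IsClopen V ∧ (x i : OmegaOne) ∈ V ∧
      ((↑) : A i → OmegaOne) ⁻¹' V ⊆ t i := by
    intro i
    have h := ht i
    rw [nhds_subtype_eq_comap, mem_comap] at h
    obtain ⟨w, hw, hwt⟩ := h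
    obtain ⟨V, h1, h2, h3⟩ := exists_isClopen_subset hw
    exact ⟨V, h1, h2, (preimage_mono h3).trans hwt⟩
  choose V hV hxV hVt using this
  refine ⟨⋂ i, (fun y : (i : Fin n) → A i => (y i : OmegaOne)) ⁻¹' V i,
    isClopen_iInter_of_finite fun i => (hV i).preimage (by fun_prop), mem_iInter.2 hxV, ?_⟩
  exact fun y hy => hts fun i _ => hVt i (mem_iInter.1 hy i)

/-- Two points are equivalent if, in every coordinate `i`, no member of `D i` and no member of `l`
separates them. -/
def cutSetoid (A : Fin n → Set OmegaOne) (D : Fin n → Set OmegaOne) (l : List OmegaOne) :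
    Setoid ((i : Fin n) → A i) where
  r x y := ∀ i, (∀ d ∈ D i, (x i : OmegaOne) < d ↔ (y i : OmegaOne) < d) ∧
    ∀ z ∈ l, (x i : OmegaOne) ≤ z ↔ (y i : OmegaOne) ≤ z
  iseqv :=
    { refl := fun _ _ => ⟨fun _ _ => Iff.rfl, fun _ _ => Iff.rfl⟩
      symm := fun h i => ⟨fun d hd => ((h i).1 d hd).symm, fun z hz => ((h i).2 z hz).symm⟩
      trans := fun h h' i => ⟨fun d hd => ((h i).1 d hd).trans ((h' i).1 d hd),
        fun z hz => ((h i).2 z hz).trans ((h' i).2 z hz)⟩ }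

theorem eventually_le_iff (x z : OmegaOne) : ∀ᶠ y in 𝓝 x, (x ≤ z ↔ y ≤ z) := by
  by_cases h : x ≤ z
  · filter_upwards [(isClopen_Iic z).2.mem_nhds h] with y hy using iff_of_true h hy
  · filter_upwards [(isClopen_Iic z).compl.2.mem_nhds h] with y hy using iff_of_false h hy

theorem eventually_lt_iff {D : Set OmegaOne} (hD : IsClosed D) {x : OmegaOne} (hx : x ∉ D) :
    ∀ᶠ y in 𝓝 x, ∀ d ∈ D, (x < d ↔ y < d) := by
  by_cases h : ∃ y, y < x
  · obtain ⟨y, hy⟩ := h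
    obtain ⟨z, hz, hzs⟩ := exists_Ioc_subset hy (hD.isOpen_compl.mem_nhds hx)
    filter_upwards [(isClopen_Ioi z).2.mem_nhds hz, (isClopen_Iic x).2.mem_nhds self_mem_Iic]
      with y hy hyx d hd
    refine ⟨fun h => (mem_Iic.1 hyx).trans_lt h, fun h => ?_⟩
    by_contra hxd
    exact hzs ⟨(mem_Ioi.1 hy).trans h, not_lt.1 hxd⟩ hd
  · filter_upwards [(isClopen_Iic x).2.mem_nhds self_mem_Iic] with y hy d _
    rw [le_antisymm (mem_Iic.1 hy) (not_lt.1 fun hyx => h ⟨y, hyx⟩)]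

theorem isOpen_cutSetoid {D : Fin n → Set OmegaOne} (hD : ∀ i, IsClosed (D i))
    (hAD : ∀ i, Disjoint (A i) (D i)) (l : List OmegaOne) (x : (i : Fin n) → A i) :
    IsOpen {y | cutSetoid A D l x y} := by
  refine isOpen_iff_mem_nhds.2 fun y hy => ?_
  have h : ∀ᶠ y' in 𝓝 y, cutSetoid A D l y y' := by
    refine eventually_all.2 fun i => ?_
    have hc : Tendsto (fun y : (i : Fin n) → A i => (y i : OmegaOne)) (𝓝 y) (𝓝 (y i)) :=
      Continuous.tendsto (by fun_prop) y
    refine (hc.eventually (eventually_lt_iff (hD i)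
      (disjoint_left.1 (hAD i) (y i).2))).and ?_
    have : ∀ z ∈ {z | z ∈ l}, ∀ᶠ y' in 𝓝 y, ((y i : OmegaOne) ≤ z ↔ (y' i : OmegaOne) ≤ z) :=
      fun z _ => hc.eventually (eventually_le_iff _ z)
    exact (eventually_all_finite l.finite_toSet).2 this
  exact h.mono fun y' hy' => Setoid.trans' _ hy hy'

/-- The set of points that belong to all stationary factors. -/
def stationaryCore (A : Fin n → Set OmegaOne) : Set OmegaOne :=
  ⋂ i ∈ {i | Stationary (A i)}, A i

/-- Closed sets `D i` disjoint from `A i` that contain, for nonstationary `A i`, all ordinals closed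
under some function. -/
theorem exists_clubs (A : Fin n → Set OmegaOne) :
    ∃ (D : Fin n → Set OmegaOne) (f : OmegaOne → OmegaOne), (∀ i, IsClosed (D i)) ∧
      (∀ i, Disjoint (A i) (D i)) ∧ (∀ i, ¬ Stationary (A i) → ∀ α, ∃ δ ∈ D i, α < δ) ∧
      ∀ α δ, α < δ → (∀ x < δ, f x < δ) → ∀ i, ¬ Stationary (A i) → δ ∈ D i := by
  have : ∀ i, ∃ (D : Set OmegaOne) (f : OmegaOne → OmegaOne), IsClosed D ∧ Disjoint (A i) D ∧
      (¬ Stationary (A i) → ∀ α, ∃ δ ∈ D, α < δ) ∧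
      (¬ Stationary (A i) → ∀ α δ, α < δ → (∀ x < δ, f x < δ) → δ ∈ D) := by
    intro i
    by_cases h : Stationary (A i)
    · exact ⟨∅, id, isClosed_empty, disjoint_empty _, fun h' => (h' h).elim, fun h' => (h' h).elim⟩
    · obtain ⟨D, f, h1, h2, h3, h4⟩ := exists_club_of_not_stationary h
      exact ⟨D, f, h1, h3, fun _ => h2, fun _ => h4⟩
  choose D f h1 h2 h3 h4 using this
  choose F hF using fun x => exists_forall_lt fun i => f i x
  exact ⟨D, F, h1, h2, h3, fun α δ hα hδ i hi =>
    h4 i hi α δ hα fun x hx => (hF x i).trans (hδ x hx)⟩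

/-- Against `σ`, Player I fixes `δ` in the core, closed under the responses of `σ` to finite lists
of cuts, and cuts successively at an enumeration of `Iio δ`. A point `y` in the final intersection
decides the side of every cut, so the play converges to `min (y i) δ` in each coordinate. -/
theorem isSemiProximal_of_stationary (hA : Stationary (stationaryCore A)) :
    IsSemiProximal ((i : Fin n) → A i) := by
  obtain ⟨u, hut, hu⟩ := exists_uniformSpace_of_clopen_nhds
    (X := (i : Fin n) → A i) fun x s hs => exists_isClopen_subset_pi x hs
  refine ⟨u, hut, ?_⟩
  rintro ⟨σ, hσ⟩
  obtain ⟨D, f, hD, hAD, -, hDf⟩ := exists_clubs A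
  let E : List OmegaOne → Set (((i : Fin n) → A i) × ((i : Fin n) → A i)) :=
    fun l => {p | cutSetoid A D l p.1 p.2}
  have hE : ∀ l, E l ∈ 𝓤[u] := fun l => hu _ (isOpen_cutSetoid hD hAD l)
  -- The list `l` encodes a partial play: Player I's move in inning `i` uses its first `i` cuts, so
  -- inning `0` uses none.
  let G : List OmegaOne → (i : Fin n) → A i := fun l => σ l.length fun i => E (l.take i)
  choose g hg using fun l => exists_forall_lt fun i => (G l i : OmegaOne)
  obtain ⟨α⟩ := (inferInstance : Nonempty OmegaOne)
  obtain ⟨δ, hδA, hαδ, hδf, hδg⟩ := hA.exists_closed_list g f α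
  obtain ⟨z, hz⟩ := exists_seq_range_eq_Iio hαδ
  let L : ℕ → List OmegaOne := fun k => (List.range k).map z
  have hL : ∀ {k w}, w ∈ L k ↔ ∃ j < k, z j = w := by simp [L]
  have hzδ : ∀ j, z j < δ := fun j => by
    have : z j ∈ Iio δ := hz ▸ mem_range_self j
    exact this
  have hplay : ∀ k, σ.play (fun k => E (L k)) k = G (L k) := by
    intro k
    have key : ∀ (l : List OmegaOne) (m : ℕ), l.length = m →
        σ m (fun i => E (l.take i)) = G l := by
      rintro l m rfl
      rfl
    rw [← key (L k) k (by simp [L])]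
    unfold ProximalStrategyII.play
    congr 1
    funext i
    have : (i : ℕ) ≤ k := Nat.lt_succ_iff.1 i.2
    simp [L, ← List.map_take, List.take_range, this]
  have hlt : ∀ k i, (σ.play (fun k => E (L k)) k i : OmegaOne) < δ := by
    intro k i
    rw [hplay]
    refine (hg (L k) i).trans (hδg _ fun w hw => ?_)
    obtain ⟨j, -, rfl⟩ := hL.1 hw
    exact hzδ j
  refine (hσ (fun k => E (L k)) ⟨fun k => hE _, fun k p hp i => ⟨(hp i).1, fun w hw => ?_⟩⟩).2 ?_
  · obtain ⟨j, hj, rfl⟩ := hL.1 hw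
    exact (hp i).2 _ (hL.2 ⟨j, hj.trans (Nat.lt_succ_self k), rfl⟩)
  rw [hut]
  rcases eq_empty_or_nonempty (⋂ k, {y | (σ.play (fun k => E (L k)) k, y) ∈ E (L k)}) with h | h
  · exact Or.inl h
  right
  obtain ⟨y, hy⟩ := h
  rw [mem_iInter] at hy
  have hlim : ∀ i, Tendsto (fun k => (σ.play (fun k => E (L k)) k i : OmegaOne)) atTop
      (𝓝 (min (y i : OmegaOne) δ)) := by
    refine fun i => tendsto_min (fun k => hlt k i) fun w hw => ?_
    have hw' : w ∈ range z := hz ▸ mem_Iio.2 hw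
    obtain ⟨j, rfl⟩ := hw'
    filter_upwards [eventually_gt_atTop j] with k hk
    exact (hy k i).2 _ (hL.2 ⟨j, hk, rfl⟩)
  have hmem : ∀ i, min (y i : OmegaOne) δ ∈ A i := by
    intro i
    rcases le_or_gt (y i : OmegaOne) δ with h | h
    · rw [min_eq_left h]
      exact (y i).2
    · rw [min_eq_right h.le]
      by_cases hi : Stationary (A i)
      · exact mem_iInter₂.1 hδA i hi
      -- For nonstationary `A i`, `δ` lies in `D i`, which every entourage respects; so `y i` is
      -- below `δ`, as the play is.
      · exact absurd (((hy 0 i).1 δ (hDf α δ hαδ hδf i hi)).1 (hlt 0 i)) h.not_gt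
  refine ⟨fun i => ⟨_, hmem i⟩, tendsto_pi_nhds.2 fun i => tendsto_subtype_rng.2 (hlim i)⟩

end OmegaOne

/-! ### Clopen separation and normality -/

/-- Within `Y`, the sets `F` and `G` are separated by a clopen set. -/
def ClopenSeparatedOn {X : Type*} [TopologicalSpace X] (F G Y : Set X) : Prop :=
  ∃ W, IsClopen W ∧ F ∩ Y ⊆ W ∧ Disjoint W (G ∩ Y)

namespace ClopenSeparatedOn

variable {X : Type*} [TopologicalSpace X] {F G Y Z : Set X}

theorem mono (h : ClopenSeparatedOn F G Y) (hZY : Z ⊆ Y) : ClopenSeparatedOn F G Z := by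
  obtain ⟨W, h1, h2, h3⟩ := h
  exact ⟨W, h1, (inter_subset_inter_right F hZY).trans h2,
    h3.mono_right (inter_subset_inter_right G hZY)⟩

theorem of_disjoint (h : Disjoint F Y ∨ Disjoint G Y) : ClopenSeparatedOn F G Y := by
  rcases h with h | h
  · exact ⟨∅, isClopen_empty, by rw [h.inter_eq], empty_disjoint _⟩
  · exact ⟨univ, isClopen_univ, subset_univ _, by rw [h.inter_eq]; exact disjoint_empty _⟩

theorem of_partition {ι : Type*} (p : X → ι) (hp : ∀ i, IsOpen (p ⁻¹' {i}))
    (h : ∀ i, ClopenSeparatedOn F G (Y ∩ p ⁻¹' {i})) : ClopenSeparatedOn F G Y := by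
  choose W hW hFW hGW using h
  have hopen : ∀ V : ι → Set X, (∀ i, IsOpen (V i)) → IsOpen {x | x ∈ V (p x)} := by
    intro V hV
    have : {x | x ∈ V (p x)} = ⋃ i, p ⁻¹' {i} ∩ V i := by
      ext x
      simp
    rw [this]
    exact isOpen_iUnion fun i => (hp i).inter (hV i)
  refine ⟨{x | x ∈ W (p x)}, ⟨⟨?_⟩, hopen W fun i => (hW i).2⟩, ?_, ?_⟩
  · exact hopen (fun i => (W i)ᶜ) fun i => (hW i).compl.2
  · exact fun x hx => hFW (p x) ⟨hx.1, hx.2, rfl⟩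
  · rw [disjoint_left]
    exact fun x hx hx' => disjoint_left.1 (hGW (p x)) hx ⟨hx'.1, hx'.2, rfl⟩

theorem of_countable_cover {ι : Type*} [Countable ι] {V : ι → Set X} (hV : ∀ i, IsClopen (V i))
    (hY : IsClopen Y) (hYV : Y ⊆ ⋃ i, V i) (h : ∀ i, ClopenSeparatedOn F G (V i)) :
    ClopenSeparatedOn F G Y := by
  classical
  obtain ⟨e, he⟩ := exists_surjective_nat (Option ι)
  -- With `Yᶜ` added, the sets cover `X`, and the first index containing a point gives an open
  -- partition.
  let V' : Option ι → Set X := fun o => o.elim Yᶜ V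
  have hV' : ∀ o, IsClopen (V' o) := by
    rintro (_ | i)
    · exact hY.compl
    · exact hV i
  have hcov : ∀ x, ∃ k, x ∈ V' (e k) := by
    intro x
    by_cases hx : x ∈ Y
    · obtain ⟨i, hi⟩ := mem_iUnion.1 (hYV hx)
      obtain ⟨k, hk⟩ := he (some i)
      exact ⟨k, by rw [hk]; exact hi⟩
    · obtain ⟨k, hk⟩ := he none
      exact ⟨k, by rw [hk]; exact hx⟩
  refine of_partition (fun x => Nat.find (hcov x)) (fun k => ?_) fun k => ?_
  · have : (fun x => Nat.find (hcov x)) ⁻¹' {k} = V' (e k) ∩ ⋂ j ∈ Iio k, (V' (e j))ᶜ := by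
      ext x
      simp [Nat.find_eq_iff]
    rw [this]
    exact (hV' _).2.inter ((finite_Iio k).isOpen_biInter fun j _ => (hV' _).compl.2)
  · have hsub : Y ∩ (fun x => Nat.find (hcov x)) ⁻¹' {k} ⊆ Y ∩ V' (e k) := by
      rintro x ⟨hx, hk⟩
      refine ⟨hx, ?_⟩
      have := Nat.find_spec (hcov x)
      rwa [show Nat.find (hcov x) = k from hk] at this
    refine mono ?_ hsub
    rcases e k with _ | i
    · refine of_disjoint (Or.inl ?_)
      rw [show Y ∩ V' none = ∅ from inter_compl_self Y]
      exact disjoint_empty _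
    · exact (h i).mono inter_subset_right

end ClopenSeparatedOn

namespace OmegaOne

variable {n : ℕ} {A : Fin n → Set OmegaOne}

/-- The box of the points that lie, in the coordinates outside `T`, on the same side of all members
of `l` as `x`, and above all members of `l` in the coordinates in `T`. -/
def box (T : Finset (Fin n)) (x : (i : Fin n) → A i) (l : List OmegaOne) :
    Set ((i : Fin n) → A i) :=
  {y | ∀ i, ∀ z ∈ l, (i ∈ T → z < y i) ∧ (i ∉ T → ((y i : OmegaOne) ≤ z ↔ (x i : OmegaOne) ≤ z))}

theorem isClopen_setOf_coord_le (i : Fin n) (z : OmegaOne) :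
    IsClopen {y : (i : Fin n) → A i | (y i : OmegaOne) ≤ z} :=
  (isClopen_Iic z).preimage (f := fun y : (i : Fin n) → A i => (y i : OmegaOne)) (by fun_prop)

theorem isClopen_box (T : Finset (Fin n)) (x : (i : Fin n) → A i) (l : List OmegaOne) :
    IsClopen (box T x l) := by
  have : box T x l = ⋂ i, ⋂ z ∈ {z | z ∈ l}, {y : (i : Fin n) → A i |
      (i ∈ T → z < y i) ∧ (i ∉ T → ((y i : OmegaOne) ≤ z ↔ (x i : OmegaOne) ≤ z))} := by
    ext y
    simp [box]
  rw [this]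
  refine isClopen_iInter_of_finite fun i => l.finite_toSet.isClopen_biInter fun z _ => ?_
  have hle := isClopen_setOf_coord_le (A := A) i z
  by_cases hi : i ∈ T
  · convert hle.compl using 1
    ext y
    simp [hi]
  · by_cases hx : (x i : OmegaOne) ≤ z
    · convert hle using 1
      ext y
      simp [hi, hx]
    · convert hle.compl using 1
      ext y
      simp [hi, hx]

/-- Otherwise each box contains a point of `F` and one of `G`. For `δ` in the core closed under
these choices, the boxes along an enumeration of `Iio δ` make both sequences converge to the point
that is `δ` on `T` and `x` elsewhere. -/
theorem exists_disjoint_box (hA : Stationary (stationaryCore A)) {F G : Set ((i : Fin n) → A i)}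
    (hF : IsClosed F) (hG : IsClosed G) (hFG : Disjoint F G) (T : Finset (Fin n))
    (hT : ∀ i ∈ T, Stationary (A i)) (x : (i : Fin n) → A i) :
    ∃ l, Disjoint F (box T x l) ∨ Disjoint G (box T x l) := by
  by_contra! h
  simp only [not_disjoint_iff] at h
  choose p hpF hp q hqG hq using fun l => (⟨(h l).1.choose, (h l).1.choose_spec.1,
    (h l).1.choose_spec.2, (h l).2.choose, (h l).2.choose_spec.1, (h l).2.choose_spec.2⟩ :
      ∃ p, ∃ _ : p ∈ F, ∃ _ : p ∈ box T x l, ∃ q, ∃ _ : q ∈ G, q ∈ box T x l)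
  choose g hg using fun l => exists_forall_lt fun i => max (p l i : OmegaOne) (q l i)
  obtain ⟨α, hα⟩ := exists_forall_lt fun i => (x i : OmegaOne)
  obtain ⟨δ, hδA, hαδ, -, hδg⟩ := hA.exists_closed_list g id α
  obtain ⟨z, hz⟩ := exists_seq_range_eq_Iio hαδ
  let L : ℕ → List OmegaOne := fun k => (List.range k).map z
  have hL : ∀ {k w}, w ∈ L k ↔ ∃ j < k, z j = w := by simp [L]
  have hzδ : ∀ k, ∀ w ∈ L k, w < δ := by
    intro k w hw
    obtain ⟨j, -, rfl⟩ := hL.1 hw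
    have : z j ∈ Iio δ := hz ▸ mem_range_self j
    exact this
  classical
  have hmem : ∀ i, (if i ∈ T then δ else x i : OmegaOne) ∈ A i := by
    intro i
    split_ifs with hi
    · exact mem_iInter₂.1 hδA i (hT i hi)
    · exact (x i).2
  have hlim : ∀ r : List OmegaOne → (i : Fin n) → A i, (∀ l, r l ∈ box T x l) →
      (∀ l i, (r l i : OmegaOne) < g l) → Tendsto (fun k => r (L k)) atTop
        (𝓝 fun i => ⟨(if i ∈ T then δ else x i : OmegaOne), hmem i⟩) := by
    intro r hr hrg
    refine tendsto_pi_nhds.2 fun i => tendsto_subtype_rng.2 ?_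
    have hle : (if i ∈ T then δ else x i : OmegaOne) ≤ δ := by
      split_ifs
      · exact le_rfl
      · exact ((hα i).trans hαδ).le
    have := tendsto_min (δ := δ) (y := (if i ∈ T then δ else x i : OmegaOne))
      (x := fun k => (r (L k) i : OmegaOne)) (fun k => (hrg _ i).trans (hδg _ (hzδ k)))
      fun w hw => ?_
    · rwa [min_eq_left hle] at this
    · have hw' : w ∈ range z := hz ▸ mem_Iio.2 hw
      obtain ⟨j, rfl⟩ := hw'
      filter_upwards [eventually_gt_atTop j] with k hk
      have hb := hr (L k) i (z j) (hL.2 ⟨j, hk, rfl⟩)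
      split_ifs with hi
      · exact iff_of_false (hb.1 hi).not_ge hw.not_ge
      · exact hb.2 hi
  have h1 := hF.mem_of_tendsto
    (hlim p hp fun l i => (le_max_left _ _).trans_lt (hg l i)) (Eventually.of_forall fun k => hpF _)
  have h2 := hG.mem_of_tendsto
    (hlim q hq fun l i => (le_max_right _ _).trans_lt (hg l i)) (Eventually.of_forall fun k => hqG _)
  exact disjoint_left.1 hFG h1 h2

/-- Strong induction on the set `T` of coordinates left unbounded: bounding one more of them reduces
to a smaller set. -/
theorem clopenSeparatedOn_bounded (hA : Stationary (stationaryCore A))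
    {F G : Set ((i : Fin n) → A i)} (hF : IsClosed F) (hG : IsClosed G) (hFG : Disjoint F G)
    (T : Finset (Fin n)) (β : OmegaOne) :
    ClopenSeparatedOn F G {x : (i : Fin n) → A i | ∀ i ∉ T, (x i : OmegaOne) ≤ β} := by
  classical
  induction T using Finset.strongInduction generalizing β with
  | H T ih =>
  have hstep : ∀ i ∈ T, ∀ γ : OmegaOne, ClopenSeparatedOn F G
      {x : (i : Fin n) → A i | (∀ i ∉ T, (x i : OmegaOne) ≤ β) ∧ (x i : OmegaOne) ≤ γ} := by
    refine fun i hi γ => (ih (T.erase i) (Finset.erase_ssubset hi) (max β γ)).mono ?_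
    intro x hx j hj
    by_cases hji : j = i
    · exact hji ▸ le_max_of_le_right hx.2
    · exact le_max_of_le_left (hx.1 j fun hjT => hj (Finset.mem_erase.2 ⟨hji, hjT⟩))
  by_cases hT : ∀ i ∈ T, Stationary (A i)
  -- The bounded coordinates take only countably many values. One box for each value covers all
  -- points whose coordinates in `T` exceed a common `γ`; the other points have a coordinate in `T`
  -- bounded by `γ`.
  · let ρ : ((i : Fin n) → A i) → {i // i ∉ T} → OmegaOne := fun x i => x i
    have hc : (ρ '' {x : (i : Fin n) → A i | ∀ i ∉ T, (x i : OmegaOne) ≤ β}).Countable := by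
      refine (countable_univ_pi fun _ : {i // i ∉ T} => countable_Iic β).mono ?_
      rintro _ ⟨x, hx, rfl⟩ i -
      exact hx i i.2
    have := hc.to_subtype
    choose x hxβ hxρ using
      fun c : ρ '' {x : (i : Fin n) → A i | ∀ i ∉ T, (x i : OmegaOne) ≤ β} => c.2
    choose l hl using fun c => exists_disjoint_box hA hF hG hFG T hT (x c)
    obtain ⟨γ, hγ⟩ : ∃ γ, ∀ c, ∀ z ∈ l c, z < γ := by
      obtain ⟨γ, hγ⟩ := exists_forall_lt_of_countable
        (countable_iUnion fun c => (l c).finite_toSet.countable)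
      exact ⟨γ, fun c z hz => hγ z (mem_iUnion.2 ⟨c, hz⟩)⟩
    have hY : IsClopen {x : (i : Fin n) → A i | ∀ i ∉ T, (x i : OmegaOne) ≤ β} := by
      have : {x : (i : Fin n) → A i | ∀ i ∉ T, (x i : OmegaOne) ≤ β} =
          ⋂ i : {i // i ∉ T}, {x : (i : Fin n) → A i | (x i : OmegaOne) ≤ β} := by
        ext
        simp
      rw [this]
      exact isClopen_iInter_of_finite fun i => isClopen_setOf_coord_le i.1 β
    refine ClopenSeparatedOn.of_countable_cover (V := fun c => Sum.elim
      (fun c => box T (x c) (l c)) (fun i : T => {x : (i : Fin n) → A i |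
        (∀ i ∉ T, (x i : OmegaOne) ≤ β) ∧ (x i : OmegaOne) ≤ γ}) c) ?_ hY ?_ ?_
    · rintro (c | i)
      · exact isClopen_box _ _ _
      · exact hY.inter (isClopen_setOf_coord_le i.1 γ)
    · intro y hy
      rw [mem_iUnion]
      by_cases h : ∃ i ∈ T, (y i : OmegaOne) ≤ γ
      · obtain ⟨i, hi, hiγ⟩ := h
        exact ⟨Sum.inr ⟨i, hi⟩, hy, hiγ⟩
      · push Not at h
        refine ⟨Sum.inl ⟨ρ y, y, hy, rfl⟩, fun i z hz => ⟨fun hi => (hγ _ z hz).trans (h i hi),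
          fun hi => ?_⟩⟩
        have h1 : (x ⟨ρ y, y, hy, rfl⟩ i : OmegaOne) = y i :=
          congrFun (hxρ ⟨ρ y, y, hy, rfl⟩) ⟨i, hi⟩
        rw [h1]
    · rintro (c | i)
      · exact ClopenSeparatedOn.of_disjoint (hl c)
      · exact hstep i.1 i.2 γ
  · push Not at hT
    obtain ⟨i, hiT, hi⟩ := hT
    -- The club missing `A i` is unbounded, so each class of the induced open partition is bounded
    -- in coordinate `i`.
    obtain ⟨D, -, hD, hAD, hDu, -⟩ := exists_clubs A
    refine ClopenSeparatedOn.of_partition (Quotient.mk (cutSetoid A D [])) ?_ ?_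
    · refine Quotient.ind fun x => ?_
      convert isOpen_cutSetoid hD hAD [] x using 1
      ext y
      exact ⟨fun h => Setoid.symm' _ (Quotient.exact h), fun h => Quotient.sound (Setoid.symm' _ h)⟩
    · refine Quotient.ind fun x => ?_
      obtain ⟨d, hd, hxd⟩ := hDu i hi (x i)
      refine (hstep i hiT d).mono fun y hy => ⟨hy.1, ?_⟩
      exact (((Quotient.exact hy.2 : cutSetoid A D [] y x) i).1 d hd).2 hxd |>.le

theorem normalSpace_of_stationary (hA : Stationary (stationaryCore A)) :
    NormalSpace ((i : Fin n) → A i) := by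
  refine ⟨fun F G hF hG hFG => ?_⟩
  obtain ⟨β⟩ := (inferInstance : Nonempty OmegaOne)
  obtain ⟨W, hW, h1, h2⟩ := clopenSeparatedOn_bounded hA hF hG hFG Finset.univ β
  have h3 : ∀ x, x ∈ {x : (i : Fin n) → A i | ∀ i ∉ Finset.univ, (x i : OmegaOne) ≤ β} :=
    fun x i hi => absurd (Finset.mem_univ i) hi
  exact ⟨W, Wᶜ, hW.2, hW.compl.2, fun x hx => h1 ⟨hx, h3 x⟩,
    fun x hx hxW => disjoint_left.1 h2 hxW ⟨hx, h3 x⟩, disjoint_compl_right⟩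

end OmegaOne

/-! ### Products of two disjoint stationary sets -/

namespace OmegaOne

variable {B C : Set OmegaOne}

theorem exists_Ioc_subtype {S : Set OmegaOne} {x : S} {y : OmegaOne} (hy : y < x) {s : Set S}
    (hs : s ∈ 𝓝 x) : ∃ z < (x : OmegaOne), ∀ x' : S, z < x' → (x' : OmegaOne) ≤ x → x' ∈ s := by
  rw [nhds_subtype_eq_comap, mem_comap] at hs
  obtain ⟨t, ht, hts⟩ := hs
  obtain ⟨z, hz, hzt⟩ := exists_Ioc_subset hy ht
  exact ⟨z, hz, fun x' h1 h2 => hts (hzt ⟨h1, h2⟩)⟩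

/-- With `m z` the least element of `C` above `z`, the graph of `m` over `B` cannot be separated
from the points above the diagonal whose second coordinate is closed under `m`. -/
theorem not_normalSpace_prod (hB : Stationary B) (hC : Stationary C) (hBC : Disjoint B C) :
    ¬ NormalSpace (B × C) := by
  intro hN
  have hne : ∀ p : B × C, (p.1 : OmegaOne) ≠ p.2 := fun p h =>
    disjoint_left.1 hBC p.1.2 (h ▸ p.2.2)
  have hm : ∀ z, ∃ m ∈ C, z < m ∧ ∀ c ∈ C, z < c → m ≤ c := by
    intro z
    have hne : (C ∩ Ioi z).Nonempty := hC.exists_gt z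
    exact ⟨_, (wellFounded_lt.min_mem _ hne).1, (wellFounded_lt.min_mem _ hne).2,
      fun c hc hzc => not_lt.1 (wellFounded_lt.not_lt_min (C ∩ Ioi z) ⟨hc, hzc⟩)⟩
  choose m hmC hzm hm using hm
  have hle : IsClosed {p : B × C | (p.1 : OmegaOne) ≤ p.2} :=
    isClosed_le (by fun_prop) (by fun_prop)
  have hF : IsClosed ({p : B × C | (p.1 : OmegaOne) ≤ p.2} ∩
      ⋂ c ∈ C, {p : B × C | c ≤ (p.1 : OmegaOne)} ∪ {p : B × C | (p.2 : OmegaOne) ≤ c}) :=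
    hle.inter (isClosed_biInter fun c _ => (isClosed_le (by fun_prop) (by fun_prop)).union
      (isClosed_le (by fun_prop) (by fun_prop)))
  have hG : IsClosed ({p : B × C | (p.1 : OmegaOne) ≤ p.2} ∩
      ⋂ z, {p : B × C | (p.2 : OmegaOne) ≤ z} ∪ {p : B × C | m z < (p.2 : OmegaOne)}) :=
    hle.inter (isClosed_iInter fun z => (isClosed_le (by fun_prop) (by fun_prop)).union
      ((isClopen_Ioi (m z)).1.preimage
        (f := fun p : B × C => (p.2 : OmegaOne)) (by fun_prop)))
  obtain ⟨U, hU, hFU, hUG⟩ := normal_exists_closure_subset hF hG.isOpen_compl (by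
    rintro p ⟨h1, h2⟩ ⟨-, h3⟩
    have hlt : (p.1 : OmegaOne) < p.2 := lt_of_le_of_ne h1 (hne p)
    rcases mem_iInter.1 h3 p.1 with h | h
    · exact hlt.not_ge (mem_ofPred.1 h)
    · rcases mem_iInter₂.1 h2 (m p.1) (hmC _) with h' | h'
      · exact (hzm (p.1 : OmegaOne)).not_ge h'
      · exact (mem_ofPred.1 h).not_ge (mem_ofPred.1 h'))
  have hr : ∀ b, ∃ r, ∀ hb : b ∈ B, (∃ y, y < b) → r < b ∧
      ∀ b' : B, r < b' → (b' : OmegaOne) ≤ b → (b', (⟨m b, hmC b⟩ : C)) ∈ U := by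
    intro b
    by_cases h : b ∈ B ∧ ∃ y, y < b
    · obtain ⟨hb, y, hy⟩ := h
      have hmem : ((⟨b, hb⟩ : B), (⟨m b, hmC b⟩ : C)) ∈ U := by
        refine hFU ⟨(hzm b).le, mem_iInter₂.2 fun c hc => ?_⟩
        rcases le_or_gt c b with h | h
        · exact Or.inl h
        · exact Or.inr (hm b c hc h)
      have hcont : Continuous fun b' : B => (b', (⟨m b, hmC b⟩ : C)) := by fun_prop
      obtain ⟨r, h1, h2⟩ := exists_Ioc_subtype (x := (⟨b, hb⟩ : B)) hy
        ((hU.preimage hcont).mem_nhds hmem)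
      exact ⟨r, fun _ _ => ⟨h1, h2⟩⟩
    · exact ⟨b, fun hb hy => (h ⟨hb, hy⟩).elim⟩
  choose r hr using hr
  -- For a fixed `b ∈ B` above `γ`, `U` then contains `(b, m x)` for unboundedly many `x`. A
  -- suitably closed `c ∈ C` is a limit of such `m x`.
  obtain ⟨γ, hγ⟩ := hB.press_down fun x hx hy => (hr x hx hy).1
  choose x hxB hx hxr using hγ
  obtain ⟨b, hb, hγb⟩ := hB.exists_gt γ
  obtain ⟨c, hc, hbc, hcl⟩ := hC.exists_closed (fun z => max (m z) (m (x (max z b)))) b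
  have hcont : Continuous fun c' : C => ((⟨b, hb⟩ : B), c') := by fun_prop
  have hcU : ((⟨b, hb⟩ : B), (⟨c, hc⟩ : C)) ∈ closure U := by
    refine map_mem_closure (s := {c' : C | ((⟨b, hb⟩ : B), c') ∈ U}) hcont ?_ fun _ h => h
    refine mem_closure_iff_nhds.2 fun s hs => ?_
    obtain ⟨z, hzc, hzs⟩ := exists_Ioc_subtype (x := (⟨c, hc⟩ : C)) hbc hs
    have hβ := hx (max z b)
    have hxm := hzm (x (max z b))
    have h1 : m (x (max z b)) < c := (le_max_right _ _).trans_lt (hcl z hzc)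
    refine ⟨⟨m (x (max z b)), hmC _⟩, hzs _ ((le_max_left z b).trans_lt (hβ.trans hxm)) h1.le, ?_⟩
    refine (hr _ (hxB _) ⟨_, hβ⟩).2 ⟨b, hb⟩ ((hxr _).trans_lt hγb) ?_
    exact (le_max_right z b).trans hβ.le
  refine hUG hcU ⟨hbc.le, mem_iInter.2 fun z => ?_⟩
  rcases le_or_gt c z with h | h
  · exact Or.inl h
  · exact Or.inr ((le_max_left _ _).trans_lt (hcl z h))

theorem exists_four_chain {Y : Type*} [UniformSpace Y] {U : Set (Y × Y)} (hU : U ∈ 𝓤 Y) :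
    ∃ W ∈ 𝓤 Y, (∀ a b, (a, b) ∈ W → (b, a) ∈ W) ∧ (∀ a, (a, a) ∈ W) ∧
      ∀ a b c d e, (a, b) ∈ W → (b, c) ∈ W → (c, d) ∈ W → (d, e) ∈ W → (a, e) ∈ U := by
  obtain ⟨V, hV, -, hVU⟩ := comp_symm_mem_uniformity_sets hU
  obtain ⟨W, hW, hWs, hWV⟩ := comp_symm_mem_uniformity_sets hV
  exact ⟨W, hW, fun a b h => hWs.symm _ _ h, fun a => refl_mem_uniformity hW,
    fun a b c d e h1 h2 h3 h4 => hVU ⟨c, hWV ⟨b, h1, h2⟩, hWV ⟨d, h3, h4⟩⟩⟩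

/-- A continuous map from a stationary set to a uniform space is Cauchy at infinity. -/
theorem Stationary.exists_tail {Y : Type*} [UniformSpace Y] (hC : Stationary C) {ψ : C → Y}
    (hψ : Continuous ψ) {U : Set (Y × Y)} (hU : U ∈ 𝓤 Y) :
    ∃ η : OmegaOne, ∀ c c' : C, η < c → η < c' → (ψ c, ψ c') ∈ U := by
  obtain ⟨W, hW, hWs, hWr, hWU⟩ := exists_four_chain hU
  have hr : ∀ c, ∃ r, ∀ hc : c ∈ C, (∃ y, y < c) → r < c ∧
      ∀ c' : C, r < c' → (c' : OmegaOne) ≤ c → (ψ ⟨c, hc⟩, ψ c') ∈ W := by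
    intro c
    by_cases h : c ∈ C ∧ ∃ y, y < c
    · obtain ⟨hc, y, hy⟩ := h
      obtain ⟨r, h1, h2⟩ := exists_Ioc_subtype (x := (⟨c, hc⟩ : C)) hy
        (hψ.continuousAt (UniformSpace.ball_mem_nhds _ hW))
      exact ⟨r, fun _ _ => ⟨h1, h2⟩⟩
    · exact ⟨c, fun hc hy => (h ⟨hc, hy⟩).elim⟩
  choose r hr using hr
  obtain ⟨η, hη⟩ := hC.press_down fun x hx hy => (hr x hx hy).1
  refine ⟨η, fun c c' hc hc' => ?_⟩
  obtain ⟨x, hx, hcx, hrx⟩ := hη (max c c')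
  have h1 := (hr x hx ⟨_, hcx⟩).2 c (hrx.trans_lt hc) ((le_max_left _ _).trans hcx.le)
  have h2 := (hr x hx ⟨_, hcx⟩).2 c' (hrx.trans_lt hc') ((le_max_right _ _).trans hcx.le)
  exact hWU _ _ _ _ _ (hWs _ _ h1) h2 (hWr _) (hWr _)

/-- A continuous map from a product of two stationary sets to a uniform space is Cauchy along the
points whose first coordinate is large and whose second coordinate is large relative to the
first. -/
theorem exists_tail_prod {Y : Type*} [UniformSpace Y] (hB : Stationary B) (hC : Stationary C)
    {φ : B × C → Y} (hφ : Continuous φ) {U : Set (Y × Y)} (hU : U ∈ 𝓤 Y) :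
    ∃ (γ : OmegaOne) (h : OmegaOne → OmegaOne), ∀ p q : B × C, γ < p.1 → h p.1 < p.2 →
      γ < q.1 → h q.1 < q.2 → (φ p, φ q) ∈ U := by
  obtain ⟨V, hV, hVs, hVr, hVU⟩ := exists_four_chain hU
  obtain ⟨W, hW, hWs, hWr, hWV⟩ := exists_four_chain hV
  have hsub : ∀ a b, (a, b) ∈ W → (a, b) ∈ V := fun a b h =>
    hWV _ _ _ _ _ h (hWr _) (hWr _) (hWr _)
  have hh : ∀ b : OmegaOne, ∃ η : OmegaOne, ∀ hb : b ∈ B, ∀ c c' : C, η < c → η < c' →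
      (φ (⟨b, hb⟩, c), φ (⟨b, hb⟩, c')) ∈ W := by
    intro b
    by_cases hb : b ∈ B
    · obtain ⟨η, hη⟩ := hC.exists_tail (ψ := fun c => φ (⟨b, hb⟩, c)) (by fun_prop) hW
      exact ⟨η, fun _ => hη⟩
    · exact ⟨b, fun h => (hb h).elim⟩
  choose h hh using hh
  have hr : ∀ b, ∃ r, ∀ hb : b ∈ B, (∃ y, y < b) → r < b ∧
      ∀ b' : B, r < b' → (b' : OmegaOne) ≤ b → ∀ c : C, h b < c → h b' < c →
        (φ (⟨b, hb⟩, c), φ (b', c)) ∈ V := by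
    intro b
    by_cases hb : b ∈ B ∧ ∃ y, y < b
    · obtain ⟨hb, y, hy⟩ := hb
      have hrc : ∀ c : C, ∃ r < b, ∀ b' : B, r < b' → (b' : OmegaOne) ≤ b →
          (φ (⟨b, hb⟩, c), φ (b', c)) ∈ W := by
        intro c
        have hcont : Continuous fun b' : B => φ (b', c) := by fun_prop
        exact exists_Ioc_subtype (x := (⟨b, hb⟩ : B)) hy
          (hcont.continuousAt (UniformSpace.ball_mem_nhds _ hW))
      choose r hrb hr using hrc
      -- Pigeonhole: `C` is unbounded, while `r` has only countably many possible values below `b`.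
      have hpig : ∃ z < b, ∀ β : OmegaOne, ∃ c : C, β < c ∧ r c = z := by
        by_contra! hcon
        have : ∀ z : Iio b, ∃ β : OmegaOne, ∀ c : C, β < c → r c ≠ z := fun z => hcon z.1 z.2
        choose β hβ using this
        have := (countable_Iio b).to_subtype
        obtain ⟨y, hy⟩ := exists_forall_lt β
        obtain ⟨c, hc, hyc⟩ := hC.exists_gt y
        exact hβ ⟨r ⟨c, hc⟩, hrb _⟩ ⟨c, hc⟩ ((hy _).trans hyc) rfl
      obtain ⟨z, hz, hzc⟩ := hpig
      refine ⟨z, fun _ _ => ⟨hz, fun b' h1 h2 c hc hc' => ?_⟩⟩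
      obtain ⟨c₀, hc₀, rfl⟩ := hzc (max (h b) (h b'))
      rw [max_lt_iff] at hc₀
      exact hWV _ _ _ _ _ (hh b hb c c₀ hc hc₀.1) (hr c₀ b' h1 h2)
        (hh b' b'.2 c₀ c hc₀.2 hc') (hWr _)
    · exact ⟨b, fun h1 h2 => (hb ⟨h1, h2⟩).elim⟩
  choose r hr using hr
  obtain ⟨γ, hγ⟩ := hB.press_down fun x hx hy => (hr x hx hy).1
  refine ⟨γ, h, fun p q hp hp' hq hq' => ?_⟩
  -- Both values are compared with the value at one point `(x, c)`, with `c` beyond all thresholds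
  -- involved.
  obtain ⟨x, hx, hpx, hrx⟩ := hγ (max p.1 q.1)
  obtain ⟨c, hc, hcx⟩ := hC.exists_gt (max (h x) (max (h p.1) (h q.1)))
  simp only [max_lt_iff] at hcx
  have hx' := (hr x hx ⟨_, hpx⟩).2
  have h1 := hx' p.1 (hrx.trans_lt hp) ((le_max_left _ _).trans hpx.le) ⟨c, hc⟩ hcx.1 hcx.2.1
  have h2 := hx' q.1 (hrx.trans_lt hq) ((le_max_right _ _).trans hpx.le) ⟨c, hc⟩ hcx.1 hcx.2.2
  exact hVU _ _ _ _ _ (hsub _ _ (hh p.1 p.1.2 p.2 ⟨c, hc⟩ hp' hcx.2.1)) (hVs _ _ h1) h2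
    (hsub _ _ (hh q.1 q.1.2 ⟨c, hc⟩ q.2 hcx.2.2 hq'))

theorem exists_mem_tails (hB : Stationary B) (hC : Stationary C) {ι : Type*} [Countable ι]
    (γ : ι → OmegaOne) (h : ι → OmegaOne → OmegaOne) (α : OmegaOne) :
    ∃ p : B × C, α < p.1 ∧ (p.1 : OmegaOne) < p.2 ∧ ∀ i, γ i < p.1 ∧ h i p.1 < p.2 := by
  obtain ⟨y, hy⟩ := exists_forall_lt γ
  obtain ⟨b, hb, hyb⟩ := hB.exists_gt (max α y)
  rw [max_lt_iff] at hyb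
  obtain ⟨z, hz⟩ := exists_forall_lt fun i => h i b
  obtain ⟨c, hc, hzc⟩ := hC.exists_gt (max b z)
  rw [max_lt_iff] at hzc
  exact ⟨(⟨b, hb⟩, ⟨c, hc⟩), hyb.1, hzc.1, fun i => ⟨(hy i).trans hyb.2, (hz i).trans hzc.2⟩⟩

/-- In any compatible uniformity, Player II stays in the tails belonging to all entourages played so
far. Countably many tails have a common point, so the final intersection is nonempty. -/
theorem not_isSemiProximal_of_isClosedEmbedding {X : Type*} [TopologicalSpace X]
    (hB : Stationary B) (hC : Stationary C) (hBC : Disjoint B C) {φ : B × C → X}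
    (hφ : IsClosedEmbedding φ) : ¬ IsSemiProximal X := by
  rintro ⟨u, rfl, hu⟩
  refine hu ?_
  have htail : ∀ U : Set (X × X), ∃ (γ : OmegaOne) (h : OmegaOne → OmegaOne), U ∈ 𝓤 X →
      ∀ p q : B × C, γ < p.1 → h p.1 < p.2 → γ < q.1 → h q.1 < q.2 → (φ p, φ q) ∈ U := by
    intro U
    by_cases hU : U ∈ 𝓤 X
    · obtain ⟨γ, h, H⟩ := exists_tail_prod hB hC hφ.continuous hU
      exact ⟨γ, h, fun _ => H⟩
    · obtain ⟨α⟩ := (inferInstance : Nonempty OmegaOne)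
      exact ⟨α, id, fun h => (hU h).elim⟩
  choose γ h htail using htail
  choose pick hα hlt hpick using fun (k : ℕ) (U : Fin (k + 1) → Set (X × X)) =>
    exists_mem_tails hB hC (fun i => γ (U i)) (fun i => h (U i))
  obtain ⟨α⟩ := (inferInstance : Nonempty OmegaOne)
  -- Each new point starts above the second coordinate of the previous one, so both coordinate
  -- sequences have the same limit if they converge.
  let τ : (k : ℕ) → (Fin (k + 1) → Set (X × X)) → B × C := fun k =>
    Nat.rec (motive := fun k => (Fin (k + 1) → Set (X × X)) → B × C) (fun U => pick 0 U α)
      (fun k τk U => pick (k + 1) U (τk fun i => U i.castSucc).2) k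
  have hτ : ∀ k U, ((τ k U).1 : OmegaOne) < (τ k U).2 ∧
      ∀ i, γ (U i) < (τ k U).1 ∧ h (U i) (τ k U).1 < (τ k U).2 := by
    rintro (_ | k) U
    · exact ⟨hlt 0 U _, hpick 0 U _⟩
    · exact ⟨hlt (k + 1) U _, hpick (k + 1) U _⟩
  refine ⟨fun k U => φ (τ k U), fun U hU => ?_⟩
  let p : ℕ → B × C := fun k => τ k fun i => U i
  have hp : ∀ k, ((p k).1 : OmegaOne) < (p k).2 := fun k => (hτ k _).1
  have hp' : ∀ k, ((p k).2 : OmegaOne) < (p (k + 1)).1 := fun k => hα (k + 1) _ _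
  have hpU : ∀ j k, j ≤ k → γ (U j) < (p k).1 ∧ h (U j) (p k).1 < (p k).2 := fun j k hjk =>
    (hτ k fun i => U i).2 ⟨j, Nat.lt_succ_of_le hjk⟩
  refine ⟨fun k => htail (U k) (hU.1 k) _ _ (hpU k k le_rfl).1 (hpU k k le_rfl).2
    (hpU k (k + 1) (Nat.le_succ k)).1 (hpU k (k + 1) (Nat.le_succ k)).2, ?_⟩
  rintro (hempty | ⟨a, ha⟩)
  · obtain ⟨q, -, -, hq⟩ := exists_mem_tails hB hC (fun k => γ (U k)) (fun k => h (U k)) α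
    have : φ q ∈ ⋂ k, {y : X | (ProximalStrategyII.play (fun k U => φ (τ k U)) U k, y) ∈ U k} :=
      mem_iInter.2 fun k => htail (U k) (hU.1 k) _ _ (hpU k k le_rfl).1 (hpU k k le_rfl).2
        (hq k).1 (hq k).2
    rw [hempty] at this
    exact this
  · obtain ⟨q, rfl⟩ := hφ.isClosed_range.mem_of_tendsto ha
      (Eventually.of_forall fun k => mem_range_self (p k))
    have hpq : Tendsto p atTop (𝓝 q) := hφ.isInducing.tendsto_nhds_iff.2 ha
    have h1 : Tendsto (fun k => ((p k).1 : OmegaOne)) atTop (𝓝 (q.1 : OmegaOne)) :=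
      ((continuous_subtype_val.comp continuous_fst).tendsto q).comp hpq
    have h2 : Tendsto (fun k => ((p k).2 : OmegaOne)) atTop (𝓝 (q.2 : OmegaOne)) :=
      ((continuous_subtype_val.comp continuous_snd).tendsto q).comp hpq
    have h3 : (q.1 : OmegaOne) = q.2 := le_antisymm
      (le_of_tendsto_of_tendsto' h1 h2 fun k => (hp k).le)
      (le_of_tendsto_of_tendsto' h2 (h1.comp (tendsto_add_atTop_nat 1)) fun k => (hp' k).le)
    exact disjoint_left.1 hBC q.1.2 (h3 ▸ q.2.2)

end OmegaOne

/-! ### Finding a closed copy of such a product -/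

namespace OmegaOne

variable {n : ℕ} {A : Fin n → Set OmegaOne}

/-- If intersecting with one more stationary factor always preserved stationarity, induction would
make the core stationary. -/
theorem exists_minimal_not_stationary (hA : ¬ Stationary (stationaryCore A)) :
    ∃ (T : Finset (Fin n)) (j : Fin n), T.Nonempty ∧ j ∉ T ∧ Stationary (A j) ∧
      Stationary (⋂ i ∈ T, A i) ∧ ¬ Stationary ((⋂ i ∈ T, A i) ∩ A j) := by
  classical
  by_contra! hcon
  have key : ∀ T : Finset (Fin n), (∀ i ∈ T, Stationary (A i)) → Stationary (⋂ i ∈ T, A i) := by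
    intro T
    induction T using Finset.induction_on with
    | empty => intro _; simpa using stationary_univ
    | insert j T hj ih =>
      intro hT
      have hjS := hT j (Finset.mem_insert_self j T)
      have hTS := ih fun i hi => hT i (Finset.mem_insert_of_mem hi)
      rcases T.eq_empty_or_nonempty with rfl | hne
      · simpa using hjS
      · rw [Finset.set_biInter_insert, inter_comm]
        exact hcon T j hne hj hjS hTS
  refine hA ?_
  have := key (Finset.univ.filter fun i => Stationary (A i)) (by simp)
  simpa [stationaryCore] using this

/-- The first variable is placed diagonally on `T`, the second at `j`, and the remaining coordinates
are frozen at `a`. Intersecting both sets with a club `D` that misses their intersection makes them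
disjoint. -/
theorem exists_isClosedEmbedding (hA : ¬ Stationary (stationaryCore A))
    (a : (i : Fin n) → A i) :
    ∃ (B C : Set OmegaOne) (φ : B × C → (i : Fin n) → A i), Stationary B ∧ Stationary C ∧
      Disjoint B C ∧ IsClosedEmbedding φ := by
  classical
  obtain ⟨T, j, ⟨i₀, hi₀⟩, hjT, hj, hT, hTj⟩ := exists_minimal_not_stationary hA
  obtain ⟨D, f, hD, -, hdisj, hDf⟩ := exists_club_of_not_stationary hTj
  have hinter : ∀ S, Stationary S → Stationary (S ∩ D) := by
    intro S hS g
    obtain ⟨δ, hδ, ⟨x, hx⟩, hfg⟩ := hS fun x => max (f x) (g x)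
    exact ⟨δ, ⟨hδ, hDf x δ hx fun y hy => (le_max_left _ _).trans_lt (hfg y hy)⟩, ⟨x, hx⟩,
      fun y hy => (le_max_right _ _).trans_lt (hfg y hy)⟩
  let φ : ((⋂ i ∈ T, A i) ∩ D : Set OmegaOne) × (A j ∩ D : Set OmegaOne) → (i : Fin n) → A i :=
    fun p i => if hi : i ∈ T then ⟨p.1, mem_iInter₂.1 p.1.2.1 i hi⟩
      else if hij : i = j then ⟨p.2, hij ▸ p.2.2.1⟩ else a i
  have hφT : ∀ p, ∀ i ∈ T, (φ p i : OmegaOne) = p.1 := fun p i hi => by simp [φ, hi]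
  have hφj : ∀ p, (φ p j : OmegaOne) = p.2 := fun p => by simp [φ, hjT]
  have hφa : ∀ p, ∀ i ∉ T, i ≠ j → φ p i = a i := fun p i hi hij => by simp [φ, hi, hij]
  have hφc : Continuous φ := by
    refine continuous_pi fun i => ?_
    by_cases hi : i ∈ T
    · refine continuous_induced_rng.2 ?_
      have : Subtype.val ∘ (fun p => φ p i) = fun p => (p.1 : OmegaOne) :=
        funext fun p => hφT p i hi
      rw [this]
      fun_prop
    · by_cases hij : i = j
      · subst hij
        refine continuous_induced_rng.2 ?_
        have : Subtype.val ∘ (fun p => φ p i) = fun p => (p.2 : OmegaOne) := funext hφj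
        rw [this]
        fun_prop
      · simp only [hφa _ i hi hij]
        exact continuous_const
  refine ⟨_, _, φ, hinter _ hT, hinter _ hj, ?_, ?_⟩
  · rw [disjoint_left]
    exact fun x h1 h2 => disjoint_left.1 hdisj ⟨h1.1, h2.1⟩ h1.2
  · refine ⟨IsEmbedding.of_comp (g := fun x : (i : Fin n) → A i =>
      ((x i₀ : OmegaOne), (x j : OmegaOne))) hφc (by fun_prop) ?_, ?_⟩
    · have : (fun x : (i : Fin n) → A i => ((x i₀ : OmegaOne), (x j : OmegaOne))) ∘ φ =
          Prod.map Subtype.val Subtype.val :=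
        funext fun p => Prod.ext (hφT p i₀ hi₀) (hφj p)
      rw [this]
      exact IsEmbedding.subtypeVal.prodMap IsEmbedding.subtypeVal
    -- Only equalities and membership in the closed set `D` are needed: membership in the factors is
    -- automatic in the product.
    · have : range φ = (⋂ i ∈ T, {x | (x i : OmegaOne) = x i₀}) ∩
          (⋂ i ∈ {i | i ∉ T ∧ i ≠ j}, {x | x i = a i}) ∩
          ({x | (x i₀ : OmegaOne) ∈ D} ∩ {x | (x j : OmegaOne) ∈ D}) := by
        ext x
        simp only [mem_inter_iff, mem_iInter, mem_ofPred_eq]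
        constructor
        · rintro ⟨p, rfl⟩
          refine ⟨⟨fun i hi => by rw [hφT p i hi, hφT p i₀ hi₀],
            fun i hi => hφa p i hi.1 hi.2⟩, ?_, ?_⟩
          · rw [hφT p i₀ hi₀]
            exact p.1.2.2
          · rw [hφj p]
            exact p.2.2.2
        · rintro ⟨⟨h1, h2⟩, h3, h4⟩
          refine ⟨(⟨x i₀, mem_iInter₂.2 fun i hi => h1 i hi ▸ (x i).2, h3⟩,
            ⟨x j, (x j).2, h4⟩), funext fun i => ?_⟩
          by_cases hi : i ∈ T
          · exact Subtype.ext ((hφT _ i hi).trans (h1 i hi).symm)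
          · by_cases hij : i = j
            · subst hij
              exact Subtype.ext (hφj _)
            · exact (hφa _ i hi hij).trans (h2 i ⟨hi, hij⟩).symm
      rw [this]
      refine ((isClosed_biInter fun i _ => isClosed_eq (by fun_prop) (by fun_prop)).inter
        (isClosed_biInter fun i _ => isClosed_eq (by fun_prop) (by fun_prop))).inter
        (IsClosed.inter ?_ ?_)
      · exact hD.preimage (f := fun x : (i : Fin n) → A i => (x i₀ : OmegaOne)) (by fun_prop)
      · exact hD.preimage (f := fun x : (i : Fin n) → A i => (x j : OmegaOne)) (by fun_prop)

end OmegaOne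

theorem mainTheorem2 (n : ℕ) (A : Fin n → Set OmegaOne) :
    IsSemiProximal ((i : Fin n) → A i) ↔ NormalSpace ((i : Fin n) → A i) := by
  by_cases hA : OmegaOne.Stationary (OmegaOne.stationaryCore A)
  · exact iff_of_true (OmegaOne.isSemiProximal_of_stationary hA)
      (OmegaOne.normalSpace_of_stationary hA)
  rcases isEmpty_or_nonempty ((i : Fin n) → A i) with h | ⟨⟨a⟩⟩
  -- On an empty space Player II has no strategy at all, since a strategy yields a point.
  · refine iff_of_true ⟨⊥, ?_, fun ⟨σ, _⟩ => h.elim (σ 0 fun _ => ∅)⟩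
      ⟨fun s t _ _ _ => ⟨∅, ∅, isOpen_empty, isOpen_empty, fun x => h.elim x, fun x => h.elim x,
        disjoint_empty _⟩⟩
    exact Subsingleton.elim _ _
  · obtain ⟨B, C, φ, hB, hC, hBC, hφ⟩ := OmegaOne.exists_isClosedEmbedding hA a
    exact iff_of_false (OmegaOne.not_isSemiProximal_of_isClosedEmbedding hB hC hBC hφ)
      fun _ => OmegaOne.not_normalSpace_prod hB hC hBC hφ.normalSpace
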